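/- Call a partition $\lambda=(\lambda_1\ge\cdots\ge\lambda_m\ge 1)$ a member of $\mathrm{Diff}_2^*$ if $\lambda_i-\lambda_{i+1}\ge 2$ for $1\le i<m$ and no part of $\lambda$ equals $1$. For such $\lambda$ let $\mathrm{col}^*(\lambda)$ be the partition whose parts are the lengths of the (nonempty) columns of the Ferrers diagram with rows $(\lambda_1-2m,\lambda_2-2(m-1),\ldots,\lambda_m-2)$. Theorem. Let $M\ge 1$ be an integer with $M+1\equiv 2$ or $3\pmod 5$, and let $N\ge 1$ and $k\ge 0$ be integers. The number of partitions of $N$ into parts congruent to $2$ or $3$ modulo $5$ in which $M+1$ occurs exactly $k$ times is equal to the number of partitions $\lambda\in\mathrm{Diff}_2^*$ of $N$ such that one of the following holds: (1) $\lambda$ has exactly one part, and $N=(M+1)k$ or $N=(M+1)k+i$ for some $i$ with $2\le i\le M$ or $i=M+2$; (2) $\lambda$ has between $2$ and $M$ parts (inclusive), and the number of $1$'s in $\mathrm{col}^*(\lambda)$ is between $(M+1)k$ and $(M+1)k+M$ (inclusive); (3) $\lambda$ has at least $M+1$ parts, and exactly $k$ parts of $\mathrm{col}^*(\lambda)$ equal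 $M+1$. -/

import Mathlib

/-- The parts of a partition, listed in weakly decreasing order
`[λ₁, …, λₘ]`. -/
def partsList {N : ℕ} (p : N.Partition) : List ℕ :=
  p.parts.sort (· ≥ ·)

/-- The number of parts of a partition. -/
def numParts {N : ℕ} (p : N.Partition) : ℕ :=
  p.parts.card

/-- `Diff₂`: the difference of any two consecutive parts is at least two. -/
def IsDiffTwo {N : ℕ} (p : N.Partition) : Prop :=
  (partsList p).IsChain (fun a b => b + 2 ≤ a)

/-- `Diff₂*`: the partitions in `Diff₂` with no `1` as a part. -/
def IsDiffTwoStar {N : ℕ} (p : N.Partition) : Prop :=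
  IsDiffTwo p ∧ 1 ∉ p.parts

/-- The columns of the Ferrers diagram whose rows are `μ₁, …, μₘ`: for every `j` below the
largest row there is a column (the `j`-th one, counted from zero), whose length is the number
of rows longer than `j`. -/
def ferrersColumns (μ : List ℕ) : Multiset ℕ :=
  (Multiset.range (μ.foldr max 0)).map (fun j => μ.countP (fun r => j < r))

/-- `[λ₁ - 2m, λ₂ - 2(m - 1), …, λₘ - 2]`, where `m` is the number of parts. The index `i`
starts at zero. For a partition in `Diff₂*` every entry is an honest difference, since then
`λᵢ ≥ 2(m - i + 1)` for `1 ≤ i ≤ m`. -/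
def starRows {N : ℕ} (p : N.Partition) : List ℕ :=
  (partsList p).mapIdx (fun i a => a - 2 * (numParts p - i))

/-- `col*(λ)`, as the multiset of its parts: the columns of the Ferrers diagram of
`(λ₁ - 2m, …, λₘ - 2)`. -/
def colStar {N : ℕ} (p : N.Partition) : Multiset ℕ :=
  ferrersColumns (starRows p)

/-! Write A = (M+1)k. Prescribing exactly k parts M+1 multiplies the generating function of
partitions into parts ≡ 2, 3 mod 5 by F = q^A (1 - q^(M+1)). By the second Rogers–Ramanujan identity
that function is the sum over m of q^(m(m+1))/(q)_m. Its m-th term counts the members of Diff₂* with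
m parts, because subtracting 2, 4, …, 2m from the parts and conjugating (col*) gives all partitions
with parts at most m (`card_diffTwoStar`).

The theorem follows by reading F times the m-th term combinatorially. If m ≥ M+1, the factor 1 -
q^(M+1) cancels in (q)_m, so exactly k columns have length M+1 (`card_diffTwoStar_count`). If 2 ≤ m
≤ M, then 1 - q^(M+1) = (1-q)(1+q+⋯+q^M), and the condition falls on the number of ones
(`card_diffTwoStar_count_one_mem_Icc`). The terms m = 0 and m = 1 are taken together, since the
first has a negative coefficient that the second absorbs (`coeff_one_part`).

Rogers–Ramanujan is obtained from a finite identity: two steps of a bilateral Bailey chain, started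
at the unit pair, produce a theta sum, which the finite Jacobi triple product with base q^5
evaluates. The limit is replaced by working modulo q^T, where all products and sums stabilise
(`rogers_ramanujan_of_nilpotent`). -/

/-- The `q`-Pochhammer product `(1 - q)(1 - q²)⋯(1 - qⁿ)`. -/
def qPoch {R : Type*} [CommRing R] (q : R) (n : ℕ) : R :=
  ∏ i ∈ Finset.range n, (1 - q ^ (i + 1))

/-- The inverse of `qPoch q k`, extended by zero to negative `k`. -/
noncomputable def qPochInv {R : Type*} [CommRing R] (q : R) (k : ℤ) : R :=
  if k < 0 then 0 else Ring.inverse (qPoch q k.toNat)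

/-- The coefficients `(-1)ʲ zʲ q^(j(j-1)/2)` of the theta series, where negative powers of `z = a`
are expressed through `b = q / z`. -/
def thetaCoeff {R : Type*} [CommRing R] (q a b : R) : ℤ → R
  | Int.ofNat n => (-a) ^ n * q ^ n.choose 2
  | Int.negSucc n => (-b) ^ (n + 1) * q ^ (n + 1).choose 2

/-! ### Reciprocal q-factorials and the q-Vandermonde sum. -/

section QSeries

variable {R : Type*} [CommRing R] {q : R}

theorem isUnit_qPoch (hq : ∀ n : ℕ, IsUnit (1 - q ^ (n + 1))) (n : ℕ) : IsUnit (qPoch q n) := by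
  induction n with
  | zero => simp [qPoch]
  | succ n ih =>
    rw [qPoch, Finset.prod_range_succ]
    exact ih.mul (hq n)

theorem qPoch_mul_qPochInv (hq : ∀ n : ℕ, IsUnit (1 - q ^ (n + 1))) (n : ℕ) :
    qPoch q n * qPochInv q n = 1 := by
  simp [qPochInv, Ring.mul_inverse_cancel _ (isUnit_qPoch hq n)]

theorem qPochInv_of_neg {k : ℤ} (hk : k < 0) : qPochInv q k = 0 := by
  simp [qPochInv, hk]

@[simp]
theorem qPochInv_zero : qPochInv q 0 = 1 := by
  simp [qPochInv, qPoch]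

/-- For k ≤ 0 both sides vanish, as `k.toNat = 0`. Validity at every integer lets sums be shifted
without boundary cases. -/
theorem qPochInv_sub_one (hq : ∀ n : ℕ, IsUnit (1 - q ^ (n + 1))) (k : ℤ) :
    qPochInv q (k - 1) = (1 - q ^ k.toNat) * qPochInv q k := by
  rcases le_or_gt k 0 with hk | hk
  · rw [qPochInv_of_neg (by lia), Int.toNat_of_nonpos hk]
    simp
  · obtain ⟨n, rfl⟩ : ∃ n : ℕ, k = (n + 1 : ℕ) := ⟨(k - 1).toNat, by lia⟩
    refine (isUnit_qPoch hq n).mul_left_cancel ?_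
    have h := qPoch_mul_qPochInv hq (n + 1)
    rw [qPoch, Finset.prod_range_succ, ← qPoch] at h
    rw [show ((n + 1 : ℕ) : ℤ) - 1 = n by lia, qPoch_mul_qPochInv hq, Int.toNat_natCast]
    linear_combination -h

theorem qPochInv_natCast (hq : ∀ n : ℕ, IsUnit (1 - q ^ (n + 1))) (n : ℕ) :
    qPochInv q n = (1 - q ^ (n + 1)) * qPochInv q (n + 1 : ℕ) := by
  have := qPochInv_sub_one hq (n + 1 : ℕ)
  rwa [Int.toNat_natCast, show ((n + 1 : ℕ) : ℤ) - 1 = n by lia] at this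

/-- A form of the `q`-Vandermonde summation. -/
theorem sum_qPochInv_vandermonde (hq : ∀ n : ℕ, IsUnit (1 - q ^ (n + 1))) (L a : ℕ) :
    ∑ r ∈ Finset.range (L + 1),
        q ^ (r * (r + a)) * (qPochInv q (L - r) * qPochInv q r * qPochInv q (r + a)) =
      qPochInv q L * qPochInv q (L + a) := by
  induction L generalizing a with
  | zero => simp
  | succ L ih =>
    refine (hq L).mul_left_cancel ?_
    -- q-Pascal splitting: 1 - q^(L+1) = (1 - q^(L+1-r)) + q^(L+1-r) (1 - q^r). The first piece is
    -- the case L with the same a; the second, after r ↦ r + 1, is the case L with a + 1.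
    have split : ∀ r ∈ Finset.range (L + 1 + 1),
        (1 - q ^ (L + 1)) * (q ^ (r * (r + a)) *
          (qPochInv q ((L + 1 : ℕ) - r) * qPochInv q r * qPochInv q (r + a))) =
        q ^ (r * (r + a)) * (qPochInv q (L - r) * qPochInv q r * qPochInv q (r + a)) +
        q ^ (L + 1 - r) * (q ^ (r * (r + a)) *
          (qPochInv q ((L + 1 : ℕ) - r) * qPochInv q (r - 1) * qPochInv q (r + a))) := by
      intro r hr
      have hr : r ≤ L + 1 := by simpa [Nat.lt_succ_iff] using hr
      have h1 := qPochInv_sub_one hq ((L + 1 : ℕ) - r)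
      have h2 := qPochInv_sub_one hq r
      rw [show (((L + 1 : ℕ) : ℤ) - r - 1) = L - r by push_cast; ring,
        show (((L + 1 : ℕ) : ℤ) - r).toNat = L + 1 - r by lia] at h1
      rw [Int.toNat_natCast] at h2
      rw [h1, h2]
      have h3 : q ^ (L + 1) = q ^ (L + 1 - r) * q ^ r := by rw [← pow_add]; congr 1; lia
      rw [h3]
      ring
    rw [Finset.mul_sum, Finset.sum_congr rfl split, Finset.sum_add_distrib,
      Finset.sum_range_succ, ih, Finset.sum_range_succ' (n := L + 1)]
    have shift : ∀ r ∈ Finset.range (L + 1),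
        q ^ (L + 1 - (r + 1)) * (q ^ ((r + 1) * (r + 1 + a)) *
          (qPochInv q ((L + 1 : ℕ) - (r + 1 : ℕ)) * qPochInv q ((r + 1 : ℕ) - 1) *
            qPochInv q ((r + 1 : ℕ) + a))) =
        q ^ (L + 1 + a) * (q ^ (r * (r + (a + 1 : ℕ))) *
          (qPochInv q (L - r) * qPochInv q r * qPochInv q (r + (a + 1 : ℕ)))) := by
      intro r hr
      have hr : r ≤ L := by simpa [Nat.lt_succ_iff] using hr
      have h3 : q ^ (L + 1 - (r + 1)) * q ^ ((r + 1) * (r + 1 + a)) =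
          q ^ (L + 1 + a) * q ^ (r * (r + (a + 1 : ℕ))) := by
        rw [← pow_add, ← pow_add]
        congr 1
        obtain ⟨d, rfl⟩ := Nat.exists_eq_add_of_le hr
        rw [show r + d + 1 - (r + 1) = d by lia]
        ring
      rw [← mul_assoc, h3, mul_assoc, show ((L + 1 : ℕ) : ℤ) - (r + 1 : ℕ) = L - r by lia,
        show ((r + 1 : ℕ) : ℤ) - 1 = r by lia, show ((r + 1 : ℕ) : ℤ) + a = r + (a + 1 : ℕ) by lia]
    rw [Finset.sum_congr rfl shift, ← Finset.mul_sum, ih]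
    rw [qPochInv_of_neg (k := (L : ℤ) - (L + 1 : ℕ)) (by lia),
      qPochInv_of_neg (k := ((0 : ℕ) : ℤ) - 1) (by lia)]
    have h4 := qPochInv_natCast hq L
    have h5 := qPochInv_natCast hq (L + a)
    push_cast at h4 h5 ⊢
    rw [show (L : ℤ) + a + 1 = L + 1 + a by ring] at h5
    rw [show (L : ℤ) + (a + 1) = L + 1 + a by ring, h5, h4]
    ring

/-! ### The finite Jacobi triple product. -/

theorem thetaCoeff_natCast (q a b : R) (n : ℕ) :
    thetaCoeff q a b n = (-a) ^ n * q ^ n.choose 2 := rfl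

theorem thetaCoeff_neg (q a b : R) (j : ℤ) : thetaCoeff q a b (-j) = thetaCoeff q b a j := by
  rcases j with (_ | n) | n
  · simp [thetaCoeff]
  · rfl
  · rfl

theorem thetaCoeff_succ (q a b : R) (n : ℕ) :
    thetaCoeff q a b (n + 1 : ℕ) = -(a * q ^ n) * thetaCoeff q a b n := by
  rw [thetaCoeff_natCast, thetaCoeff_natCast, Nat.choose_succ_succ' n 1, Nat.choose_one_right]
  ring

/-- Quasi-periodicity of the theta coefficients. For negative j the extra factor a meets a b, and ab
= q turns the pair into a power of q; j ≤ N keeps the exponent nonnegative. -/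
theorem mul_thetaCoeff {a b : R} (hab : a * b = q) (N : ℕ) (j : ℤ) (hj : j ≤ N) :
    a * q ^ N * thetaCoeff q a b j = -(q ^ (N - j).toNat * thetaCoeff q a b (j + 1)) := by
  rcases le_or_gt 0 j with h | h
  · lift j to ℕ using h
    have : N = (N - (j : ℤ)).toNat + j := by lia
    rw [show ((j : ℤ) + 1) = (j + 1 : ℕ) by lia, thetaCoeff_succ]
    nth_rw 1 [this]
    ring
  · obtain ⟨t, rfl⟩ : ∃ t : ℕ, j = -(t + 1 : ℕ) := ⟨(-j - 1).toNat, by lia⟩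
    rw [thetaCoeff_neg, thetaCoeff_succ, show -((t + 1 : ℕ) : ℤ) + 1 = -t by lia, thetaCoeff_neg,
      show (N - -((t + 1 : ℕ) : ℤ)).toNat = N + t + 1 by lia, pow_succ, pow_add]
    linear_combination -(q ^ N * q ^ t * thetaCoeff q b a t) * hab

/-- Multiplication by a q^N₁ shifts the theta index by one. The two resulting sums merge through 1 -
q^(n+1) = (1 - q^(n+1-k)) + q^(n+1-k) (1 - q^k) with n = N₁ + N₂. -/
theorem sum_thetaCoeff_step (hq : ∀ n : ℕ, IsUnit (1 - q ^ (n + 1))) {a b : R} (hab : a * b = q)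
    (N₁ N₂ : ℕ) :
    (1 - q ^ (N₁ + N₂ + 1)) * ∑ k ∈ Finset.range (N₁ + 1 + N₂ + 1), thetaCoeff q a b (k - N₂) *
        (qPochInv q ((N₁ + 1 + N₂ : ℕ) - k) * qPochInv q k) =
      (1 - a * q ^ N₁) * ∑ k ∈ Finset.range (N₁ + N₂ + 1), thetaCoeff q a b (k - N₂) *
        (qPochInv q ((N₁ + N₂ : ℕ) - k) * qPochInv q k) := by
  have hshift : ∀ k ∈ Finset.range (N₁ + N₂ + 1),
      a * q ^ N₁ * (thetaCoeff q a b (k - N₂) *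
        (qPochInv q ((N₁ + N₂ : ℕ) - k) * qPochInv q k)) =
      -(q ^ (N₁ + N₂ + 1 - (k + 1)) * (thetaCoeff q a b ((k + 1 : ℕ) - N₂) *
        (qPochInv q ((N₁ + N₂ + 1 : ℕ) - (k + 1 : ℕ)) * qPochInv q ((k + 1 : ℕ) - 1)))) := by
    intro k hk
    have hk : k ≤ N₁ + N₂ := by simpa [Nat.lt_succ_iff] using hk
    rw [← mul_assoc, mul_thetaCoeff hab N₁ _ (by lia),
      show (N₁ - ((k : ℤ) - N₂)).toNat = N₁ + N₂ + 1 - (k + 1) by lia,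
      show (k : ℤ) - N₂ + 1 = (k + 1 : ℕ) - N₂ by lia,
      show ((N₁ + N₂ + 1 : ℕ) : ℤ) - (k + 1 : ℕ) = (N₁ + N₂ : ℕ) - k by lia,
      show ((k + 1 : ℕ) : ℤ) - 1 = k by lia]
    ring
  rw [sub_mul 1 (a * q ^ N₁), Finset.mul_sum _ _ (a * q ^ N₁), Finset.sum_congr rfl hshift,
    Finset.sum_neg_distrib, sub_neg_eq_add, one_mul]
  -- The boundary terms k = 0 and k = N₁ + N₂ + 1 contain a reciprocal at a negative index, so both
  -- sums may be extended to the same range.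
  have hzero : q ^ (N₁ + N₂ + 1 - 0) * (thetaCoeff q a b ((0 : ℕ) - N₂) *
      (qPochInv q ((N₁ + N₂ + 1 : ℕ) - (0 : ℕ)) * qPochInv q ((0 : ℕ) - 1))) = 0 := by
    rw [qPochInv_of_neg (k := ((0 : ℕ) : ℤ) - 1) (by lia)]
    ring
  have hlast : thetaCoeff q a b ((N₁ + N₂ + 1 : ℕ) - N₂) *
      (qPochInv q ((N₁ + N₂ : ℕ) - (N₁ + N₂ + 1 : ℕ)) * qPochInv q (N₁ + N₂ + 1 : ℕ)) = 0 := by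
    rw [qPochInv_of_neg (k := ((N₁ + N₂ : ℕ) : ℤ) - (N₁ + N₂ + 1 : ℕ)) (by lia)]
    ring
  have e1 := Finset.sum_range_succ (fun k : ℕ => thetaCoeff q a b (k - N₂) *
      (qPochInv q ((N₁ + N₂ : ℕ) - k) * qPochInv q k)) (N₁ + N₂ + 1)
  have e2 := Finset.sum_range_succ' (fun k : ℕ => q ^ (N₁ + N₂ + 1 - k) *
      (thetaCoeff q a b (k - N₂) *
      (qPochInv q ((N₁ + N₂ + 1 : ℕ) - k) * qPochInv q (k - 1)))) (N₁ + N₂ + 1)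
  rw [hlast, add_zero] at e1
  rw [hzero, add_zero] at e2
  rw [← e1, ← e2, ← Finset.sum_add_distrib, Finset.mul_sum,
    show N₁ + 1 + N₂ = N₁ + N₂ + 1 by lia]
  refine Finset.sum_congr rfl fun k hk => ?_
  have hk : k ≤ N₁ + N₂ + 1 := by simpa [Nat.lt_succ_iff] using hk
  have h1 := qPochInv_sub_one hq ((N₁ + N₂ + 1 : ℕ) - k)
  have h2 := qPochInv_sub_one hq k
  rw [show (((N₁ + N₂ + 1 : ℕ) : ℤ) - k - 1) = (N₁ + N₂ : ℕ) - k by lia,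
    show (((N₁ + N₂ + 1 : ℕ) : ℤ) - k).toNat = N₁ + N₂ + 1 - k by lia] at h1
  rw [Int.toNat_natCast] at h2
  rw [h1, h2]
  have h3 : q ^ (N₁ + N₂ + 1) = q ^ (N₁ + N₂ + 1 - k) * q ^ k := by rw [← pow_add]; congr 1; lia
  rw [h3]
  ring

/-- One step of the finite triple product, in the first of its two products. -/
theorem finite_triple_product_extend (hq : ∀ n : ℕ, IsUnit (1 - q ^ (n + 1))) {a b : R}
    (hab : a * b = q) (N₁ N₂ : ℕ) (D : R)
    (h0 : qPoch q N₂ * ∑ k ∈ Finset.range (N₂ + 1), thetaCoeff q a b (k - N₂) *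
        (qPochInv q (N₂ - k) * qPochInv q k) = D) :
    qPoch q (N₁ + N₂) * ∑ k ∈ Finset.range (N₁ + N₂ + 1), thetaCoeff q a b (k - N₂) *
        (qPochInv q ((N₁ + N₂ : ℕ) - k) * qPochInv q k) =
      (∏ i ∈ Finset.range N₁, (1 - a * q ^ i)) * D := by
  induction N₁ with
  | zero => simpa using h0
  | succ n ih =>
    have h := sum_thetaCoeff_step hq hab n N₂
    rw [Finset.prod_range_succ, mul_right_comm, ← ih, mul_assoc (qPoch q (n + N₂)),
      mul_comm _ (1 - a * q ^ n), ← h, show n + 1 + N₂ = n + N₂ + 1 by lia, qPoch,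
      Finset.prod_range_succ, ← qPoch]
    ring

/-- The finite form of the Jacobi triple product. -/
theorem finite_triple_product (hq : ∀ n : ℕ, IsUnit (1 - q ^ (n + 1))) {a b : R}
    (hab : a * b = q) (N₁ N₂ : ℕ) :
    qPoch q (N₁ + N₂) * ∑ k ∈ Finset.range (N₁ + N₂ + 1), thetaCoeff q a b (k - N₂) *
        (qPochInv q ((N₁ + N₂ : ℕ) - k) * qPochInv q k) =
      (∏ i ∈ Finset.range N₁, (1 - a * q ^ i)) * ∏ i ∈ Finset.range N₂, (1 - b * q ^ i) := by
  refine finite_triple_product_extend hq hab N₁ N₂ _ ?_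
  -- The second product comes from the same induction with a and b exchanged; reflecting the
  -- summation index exchanges them back.
  have h := finite_triple_product_extend hq (a := b) (b := a) (by rw [mul_comm, hab]) N₂ 0 1
    (by simp [qPoch, thetaCoeff])
  rw [mul_one] at h
  rw [← h, add_zero, ← Finset.sum_range_reflect]
  congr 1
  refine Finset.sum_congr rfl fun k hk => ?_
  have hk : k ≤ N₂ := by simpa [Nat.lt_succ_iff] using hk
  rw [show ((N₂ + 1 - 1 - k : ℕ) : ℤ) = N₂ - k by lia, show (N₂ : ℤ) - (N₂ - k) = k by ring,
    show (N₂ : ℤ) - k - N₂ = -(k - (0 : ℕ)) by simp, thetaCoeff_neg,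
    mul_comm (qPochInv q k)]

theorem sum_range_sub_eq_sum_Icc {A : Type*} [AddCommMonoid A] (f : ℤ → A) (N₁ N₂ : ℕ) :
    ∑ k ∈ Finset.range (N₁ + N₂ + 1), f (k - N₂) = ∑ m ∈ Finset.Icc (-(N₂ : ℤ)) N₁, f m := by
  refine Finset.sum_bij (fun k _ => (k : ℤ) - N₂) ?_ ?_ ?_ ?_
  · intro k hk
    simp at hk ⊢
    lia
  · intro k _ l _ h
    lia
  · intro m hm
    rw [Finset.mem_Icc] at hm
    exact ⟨(m + N₂).toNat, by simp; lia, by lia⟩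
  · simp

theorem finite_triple_product_Icc (hq : ∀ n : ℕ, IsUnit (1 - q ^ (n + 1))) {a b : R}
    (hab : a * b = q) (N₁ N₂ : ℕ) :
    qPoch q (N₁ + N₂) * ∑ m ∈ Finset.Icc (-(N₂ : ℤ)) N₁, thetaCoeff q a b m *
        (qPochInv q (N₁ - m) * qPochInv q (N₂ + m)) =
      (∏ i ∈ Finset.range N₁, (1 - a * q ^ i)) * ∏ i ∈ Finset.range N₂, (1 - b * q ^ i) := by
  rw [← finite_triple_product hq hab, ← sum_range_sub_eq_sum_Icc]
  congr 1
  refine Finset.sum_congr rfl fun k hk => ?_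
  rw [show (N₁ : ℤ) - (k - N₂) = (N₁ + N₂ : ℕ) - k by push_cast; ring,
    show (N₂ : ℤ) + (k - N₂) = k by ring]

/-! ### The Bailey chain relative to a = q. -/

/-- The unit Bailey pair relative to `a = q`. -/
theorem sum_unit_bailey (hq : ∀ n : ℕ, IsUnit (1 - q ^ (n + 1))) (s : ℕ) :
    ∑ m ∈ Finset.Icc (-((s + 1 : ℕ) : ℤ)) s, thetaCoeff q 1 q m *
        (qPochInv q (s - m) * qPochInv q (s + m + 1)) = if s = 0 then 1 else 0 := by
  have h := finite_triple_product_Icc hq (one_mul q) s (s + 1)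
  refine (isUnit_qPoch hq (s + (s + 1))).mul_left_cancel ?_
  have e : ∀ m : ℤ, ((s + 1 : ℕ) : ℤ) + m = s + m + 1 := fun m => by push_cast; ring
  simp only [e] at h
  rw [h]
  rcases s with _ | s
  · simp [qPoch]
  -- For positive s the product with a = 1 contains the factor 1 - q^0 = 0.
  · rw [Finset.prod_range_succ' _ s]
    simp

/-- Terms with s < m vanish; putting s = m + r leaves q-Vandermonde with L = n - m and a = 2m + 1.
-/
theorem sum_qPochInv_bailey_nat (hq : ∀ n : ℕ, IsUnit (1 - q ^ (n + 1))) (n m : ℕ) (hm : m ≤ n) :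
    ∑ s ∈ Finset.range (n + 1), q ^ (s * (s + 1)) * qPochInv q (n - s) *
        (qPochInv q (s - m) * qPochInv q (s + m + 1)) =
      q ^ (m * (m + 1)) * (qPochInv q (n - m) * qPochInv q (n + m + 1)) := by
  obtain ⟨L, rfl⟩ := Nat.exists_eq_add_of_le hm
  have h := sum_qPochInv_vandermonde hq L (2 * m + 1)
  rw [show m + L + 1 = m + (L + 1) by ring, Finset.sum_range_add, Finset.sum_eq_zero, zero_add]
  · rw [show ((m + L : ℕ) : ℤ) - m = L by lia,
      show ((m + L : ℕ) : ℤ) + m + 1 = L + (2 * m + 1 : ℕ) by lia, ← h, Finset.mul_sum]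
    refine Finset.sum_congr rfl fun r _ => ?_
    rw [show ((m + L : ℕ) : ℤ) - (m + r : ℕ) = L - r by lia,
      show ((m + r : ℕ) : ℤ) - m = r by lia,
      show ((m + r : ℕ) : ℤ) + m + 1 = r + (2 * m + 1 : ℕ) by lia,
      show (m + r) * (m + r + 1) = m * (m + 1) + r * (r + (2 * m + 1)) by ring, pow_add]
    ring
  · intro s hs
    rw [Finset.mem_range] at hs
    rw [qPochInv_of_neg (k := (s : ℤ) - m) (by lia)]
    ring

theorem sum_qPochInv_bailey (hq : ∀ n : ℕ, IsUnit (1 - q ^ (n + 1))) (n : ℕ) (m : ℤ)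
    (hm : m ∈ Finset.Icc (-((n + 1 : ℕ) : ℤ)) n) :
    ∑ s ∈ Finset.range (n + 1), q ^ (s * (s + 1)) * qPochInv q (n - s) *
        (qPochInv q (s - m) * qPochInv q (s + m + 1)) =
      q ^ (m * (m + 1)).toNat * (qPochInv q (n - m) * qPochInv q (n + m + 1)) := by
  rw [Finset.mem_Icc] at hm
  rcases le_or_gt 0 m with h | h
  · lift m to ℕ using h
    rw [sum_qPochInv_bailey_nat hq n m (by lia)]
    norm_cast
  -- The reflection m ↦ -m - 1 preserves m(m+1) and exchanges the two reciprocal factors.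
  · obtain ⟨t, rfl⟩ : ∃ t : ℕ, m = -(t : ℤ) - 1 := ⟨(-m - 1).toNat, by lia⟩
    have h := sum_qPochInv_bailey_nat hq n t (by lia)
    have e1 : ∀ s : ℤ, s - (-(t : ℤ) - 1) = s + t + 1 := fun s => by ring
    have e2 : ∀ s : ℤ, s + (-(t : ℤ) - 1) + 1 = s - t := fun s => by ring
    have e3 : ((-(t : ℤ) - 1) * (-(t : ℤ) - 1 + 1)).toNat = t * (t + 1) := by
      rw [show (-(t : ℤ) - 1) * (-(t : ℤ) - 1 + 1) = (t * (t + 1) : ℕ) by push_cast; ring]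
      exact Int.toNat_natCast _
    simp only [e1, e2, e3]
    rw [mul_comm (qPochInv q (n + t + 1)), ← h]
    exact Finset.sum_congr rfl fun s _ => by ring

/-- One step of the Bailey chain relative to `a = q`. -/
theorem bailey_chain (hq : ∀ n : ℕ, IsUnit (1 - q ^ (n + 1))) (α : ℤ → R) (β : ℕ → R)
    (hβ : ∀ s : ℕ, ∑ m ∈ Finset.Icc (-((s + 1 : ℕ) : ℤ)) s, α m *
        (qPochInv q (s - m) * qPochInv q (s + m + 1)) = β s) (n : ℕ) :
    ∑ m ∈ Finset.Icc (-((n + 1 : ℕ) : ℤ)) n, q ^ (m * (m + 1)).toNat * α m *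
        (qPochInv q (n - m) * qPochInv q (n + m + 1)) =
      ∑ s ∈ Finset.range (n + 1), q ^ (s * (s + 1)) * qPochInv q (n - s) * β s := by
  have extend : ∀ s ∈ Finset.range (n + 1), q ^ (s * (s + 1)) * qPochInv q (n - s) * β s =
      ∑ m ∈ Finset.Icc (-((n + 1 : ℕ) : ℤ)) n, α m * (q ^ (s * (s + 1)) * qPochInv q (n - s) *
        (qPochInv q (s - m) * qPochInv q (s + m + 1))) := by
    intro s hs
    rw [Finset.mem_range] at hs
    rw [← hβ, Finset.mul_sum]
    refine (Finset.sum_congr rfl fun m _ => ?_).trans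
      (Finset.sum_subset (Finset.Icc_subset_Icc (by lia) (by lia)) fun m _ hm => ?_)
    · ring
    · rw [Finset.mem_Icc, not_and_or] at hm
      rcases hm with hm | hm
      · rw [qPochInv_of_neg (k := s + m + 1) (by lia)]
        ring
      · rw [qPochInv_of_neg (k := s - m) (by lia)]
        ring
  rw [Finset.sum_congr rfl extend, Finset.sum_comm]
  refine Finset.sum_congr rfl fun m hm => ?_
  rw [← Finset.mul_sum, sum_qPochInv_bailey hq n m hm]
  ring

/-- A finite form of the second Rogers–Ramanujan identity, before the triple product is applied. -/
theorem finite_rogers_ramanujan (hq : ∀ n : ℕ, IsUnit (1 - q ^ (n + 1))) (n : ℕ) :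
    ∑ m ∈ Finset.Icc (-((n + 1 : ℕ) : ℤ)) n,
        q ^ (m * (m + 1)).toNat * (q ^ (m * (m + 1)).toNat * thetaCoeff q 1 q m) *
        (qPochInv q (n - m) * qPochInv q (n + m + 1)) =
      ∑ s ∈ Finset.range (n + 1), q ^ (s * (s + 1)) * qPochInv q (n - s) * qPochInv q s := by
  -- Two chain steps: the unit pair has β supported at 0, so the first step gives β_s = 1/(q)_s,
  -- which feeds the second.
  refine bailey_chain hq _ (fun s : ℕ => qPochInv q s) (fun s => ?_) n
  rw [bailey_chain hq _ _ (sum_unit_bailey hq) s, Finset.sum_range_succ']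
  simp

/-- Both exponents equal (5m² + 3m)/2, and the signs agree; this recognises the Bailey sum as a
theta series with base q^5. -/
theorem thetaCoeff_pow_five (q : R) (m : ℤ) :
    thetaCoeff (q ^ 5) (q ^ 4) q m =
      q ^ (m * (m + 1)).toNat * (q ^ (m * (m + 1)).toNat * thetaCoeff q 1 q m) := by
  have hc : ∀ n : ℕ, n.choose 2 * 2 + n = n * n := fun n => by
    induction n with
    | zero => rfl
    | succ n ih => rw [Nat.choose_succ_succ' n 1, Nat.choose_one_right]; linarith
  rcases le_or_gt 0 m with h | h
  · lift m to ℕ using h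
    rw [show ((m : ℤ) * (m + 1)).toNat = m * (m + 1) by norm_cast, thetaCoeff_natCast,
      thetaCoeff_natCast, neg_pow, neg_pow (1 : R), one_pow, mul_one, ← pow_mul, ← pow_mul]
    have e : 4 * m + 5 * m.choose 2 = m * (m + 1) + (m * (m + 1) + m.choose 2) := by
      linarith [hc m]
    rw [mul_assoc, ← pow_add, e, pow_add, pow_add]
    ring
  · obtain ⟨t, rfl⟩ : ∃ t : ℕ, m = -(t + 1 : ℕ) := ⟨(-m - 1).toNat, by lia⟩
    have e3 : (-((t + 1 : ℕ) : ℤ) * (-((t + 1 : ℕ) : ℤ) + 1)).toNat = t * (t + 1) := by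
      rw [show -((t + 1 : ℕ) : ℤ) * (-((t + 1 : ℕ) : ℤ) + 1) = (t * (t + 1) : ℕ) by
        push_cast; ring]
      exact Int.toNat_natCast _
    rw [e3, thetaCoeff_neg, thetaCoeff_neg, thetaCoeff_natCast, thetaCoeff_natCast, neg_pow,
      ← pow_mul]
    have e : (t + 1) + 5 * (t + 1).choose 2 =
        t * (t + 1) + (t * (t + 1) + ((t + 1) + (t + 1).choose 2)) := by
      linarith [hc (t + 1)]
    rw [mul_assoc, ← pow_add, e, pow_add, pow_add, pow_add]
    ring

end QSeries

/-! ### Passage to the limit modulo q^T. -/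

section Nilpotent

variable {R : Type*} [CommRing R] {q : R}

theorem isUnit_one_sub_pow_of_nilpotent {T : ℕ} (hT : q ^ T = 0) (n : ℕ) :
    IsUnit (1 - q ^ (n + 1)) :=
  IsNilpotent.isUnit_one_sub (IsNilpotent.pow_of_pos ⟨T, hT⟩ (by lia))

theorem pow_eq_zero_of_nilpotent {T n : ℕ} (hT : q ^ T = 0) (h : T ≤ n) : q ^ n = 0 :=
  pow_eq_zero_of_le h hT

theorem qPoch_stable {T n : ℕ} (hT : q ^ T = 0) (h : T ≤ n) : qPoch q n = qPoch q T := by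
  obtain ⟨d, rfl⟩ := Nat.exists_eq_add_of_le h
  rw [qPoch, Finset.prod_range_add, ← qPoch, Finset.prod_eq_one, mul_one]
  intro i _
  rw [pow_eq_zero_of_nilpotent hT (by lia), sub_zero]

theorem qPochInv_stable {T : ℕ} {k : ℤ} (hT : q ^ T = 0) (h : T ≤ k) :
    qPochInv q k = qPochInv q T := by
  lift k to ℕ using (by lia)
  simp only [qPochInv, Int.toNat_natCast, qPoch_stable hT (n := k) (by lia)]
  rw [if_neg (by lia), if_neg (by lia)]

theorem le_toNat_mul_add_one {T : ℕ} {m : ℤ} (h : T ≤ m ∨ m < -T) :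
    T ≤ (m * (m + 1)).toNat := by
  have : (T : ℤ) ≤ m * (m + 1) := by
    rcases h with h | h <;> nlinarith
  lia

/-- The theta series of the second Rogers–Ramanujan identity, truncated. -/
theorem sum_theta_stable {T N₁ N₂ : ℕ} {f : ℤ → R} (hT : q ^ T = 0) (h₁ : T ≤ N₁) (h₂ : T ≤ N₂)
    (g : ℤ → R) (c : R) (hf : ∀ m : ℤ, -T ≤ m → m < T → f m = c) :
    ∑ m ∈ Finset.Icc (-(N₂ : ℤ)) N₁, q ^ (m * (m + 1)).toNat * g m * f m =
      c * ∑ m ∈ Finset.Icc (-(T : ℤ)) T, q ^ (m * (m + 1)).toNat * g m := by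
  rw [Finset.mul_sum]
  refine (Finset.sum_subset (Finset.Icc_subset_Icc (by lia) (by lia)) fun m _ hm => ?_).symm.trans
    (Finset.sum_congr rfl fun m hm => ?_)
  · rw [Finset.mem_Icc, not_and_or] at hm
    rw [pow_eq_zero_of_nilpotent hT (le_toNat_mul_add_one (by lia))]
    ring
  · rw [Finset.mem_Icc] at hm
    rcases hm.2.lt_or_eq with h | h
    · rw [hf m hm.1 h]
      ring
    -- The endpoint m = T lies in the truncated sum, but its term is zero, so `f T = c` is not
    -- needed.
    · rw [pow_eq_zero_of_nilpotent hT (le_toNat_mul_add_one (by lia))]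
      ring

/-- Factors are sorted by residue mod 5: classes 4, 1 and 0 form the triple product with base q^5,
leaving classes 2 and 3. -/
theorem qPoch_five_mul (q : R) (n : ℕ) :
    qPoch q (5 * n) = (∏ i ∈ Finset.range n, (1 - q ^ 4 * (q ^ 5) ^ i)) *
      (∏ i ∈ Finset.range n, (1 - q * (q ^ 5) ^ i)) * qPoch (q ^ 5) n *
      ((∏ i ∈ Finset.range n, (1 - q ^ (5 * i + 2))) *
        ∏ i ∈ Finset.range n, (1 - q ^ (5 * i + 3))) := by
  induction n with
  | zero => simp [qPoch]
  | succ n ih =>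
    have h : qPoch q (5 * (n + 1)) = qPoch q (5 * n) * (1 - q ^ (5 * n + 1)) *
        (1 - q ^ (5 * n + 2)) * (1 - q ^ (5 * n + 3)) * (1 - q ^ (5 * n + 4)) *
        (1 - q ^ (5 * n + 5)) := by
      simp only [qPoch, show 5 * (n + 1) = 5 * n + 1 + 1 + 1 + 1 + 1 by ring,
        Finset.prod_range_succ]
    have h5 : qPoch (q ^ 5) (n + 1) = qPoch (q ^ 5) n * (1 - q ^ (5 * n + 5)) := by
      rw [qPoch, Finset.prod_range_succ, ← qPoch, ← pow_mul, Nat.mul_succ]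
    rw [h, h5, ih]
    simp only [Finset.prod_range_succ, ← pow_mul, ← pow_add, ← pow_succ']
    rw [show 4 + 5 * n = 5 * n + 4 by ring]
    ring

/-- The second Rogers–Ramanujan identity modulo `q ^ T`. -/
theorem rogers_ramanujan_of_nilpotent {T : ℕ} (hT : q ^ T = 0) :
    (∑ s ∈ Finset.range T, q ^ (s * (s + 1)) * qPochInv q s) *
      ((∏ i ∈ Finset.range (2 * T), (1 - q ^ (5 * i + 2))) *
        ∏ i ∈ Finset.range (2 * T), (1 - q ^ (5 * i + 3))) = 1 := by
  have hq := isUnit_one_sub_pow_of_nilpotent hT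
  have hT5 : (q ^ 5) ^ T = 0 := by rw [← pow_mul, pow_eq_zero_of_nilpotent hT (by lia)]
  have hq5 := isUnit_one_sub_pow_of_nilpotent hT5
  set Θ : R := ∑ m ∈ Finset.Icc (-(T : ℤ)) T,
    q ^ (m * (m + 1)).toNat * (q ^ (m * (m + 1)).toNat * thetaCoeff q 1 q m) with hΘ
  have hsum : ∑ s ∈ Finset.range (2 * T + 1), q ^ (s * (s + 1)) * qPochInv q ((2 * T : ℕ) - s) *
      qPochInv q s =
      qPochInv q T * ∑ s ∈ Finset.range T, q ^ (s * (s + 1)) * qPochInv q s := by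
    rw [Finset.mul_sum]
    refine (Finset.sum_subset (Finset.range_subset_range.2 (by lia)) fun s _ hs => ?_).symm.trans
      (Finset.sum_congr rfl fun s hs => ?_)
    · rw [Finset.mem_range, not_lt] at hs
      rw [pow_eq_zero_of_nilpotent hT (by nlinarith)]
      ring
    · rw [Finset.mem_range] at hs
      rw [qPochInv_stable hT (k := (2 * T : ℕ) - s) (by lia)]
      ring
  have hfin := finite_rogers_ramanujan hq (2 * T)
  rw [hsum, sum_theta_stable hT (by lia) (by lia) _ (qPochInv q T * qPochInv q T)
    (fun m h₁ h₂ => by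
      rw [qPochInv_stable hT (k := (2 * T : ℕ) - m) (by lia),
        qPochInv_stable hT (k := (2 * T : ℕ) + m + 1) (by lia)]), ← hΘ] at hfin
  have htriple := finite_triple_product_Icc hq5 (a := q ^ 4) (b := q) (by ring) (2 * T) (2 * T)
  simp only [thetaCoeff_pow_five] at htriple
  rw [sum_theta_stable hT (by lia) (by lia) _
    (qPochInv (q ^ 5) T * qPochInv (q ^ 5) T)
    (fun m h₁ h₂ => by
      rw [qPochInv_stable hT5 (k := (2 * T : ℕ) - m) (by lia),
        qPochInv_stable hT5 (k := (2 * T : ℕ) + m) (by lia)]), ← hΘ,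
    qPoch_stable hT5 (by lia)] at htriple
  have hprod := qPoch_five_mul q (2 * T)
  rw [← htriple, qPoch_stable hT (n := 5 * (2 * T)) (by lia),
    qPoch_stable hT5 (n := 2 * T) (by lia)] at hprod
  have i1 := qPoch_mul_qPochInv hq T
  have i5 := qPoch_mul_qPochInv hq5 T
  generalize (∏ i ∈ Finset.range (2 * T), (1 - q ^ (5 * i + 2))) *
        ∏ i ∈ Finset.range (2 * T), (1 - q ^ (5 * i + 3)) = W at *
  generalize ∑ s ∈ Finset.range T, q ^ (s * (s + 1)) * qPochInv q s = S at *
  generalize qPoch q T = P at *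
  generalize qPoch (q ^ 5) T = P₅ at *
  generalize qPochInv q T = u at *
  generalize qPochInv (q ^ 5) T = u₅ at *
  -- Here u and u₅ invert P and P₅. Cancelling units leaves S = uΘ and P = ΘW, hence SW = uP = 1.
  have hS : S = u * Θ := by
    linear_combination (-P) * hfin + (-S + u * Θ) * i1
  have hP : P = Θ * W := by
    linear_combination hprod + (Θ * W) * (P₅ * u₅ + 1) * i5
  rw [hS]
  linear_combination (-u) * hP + i1

end Nilpotent

/-! ### Generating functions of restricted partitions. -/

section Counting

open PowerSeries

/-- The generating function of the partitions all of whose parts satisfy `p`. -/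
noncomputable def restrictedSeries (p : ℕ → Prop) [DecidablePred p] : ℤ⟦X⟧ :=
  PowerSeries.mk fun n => ((Nat.Partition.restricted n p).card : ℤ)

/-- The generating function of the partitions all of whose parts satisfy `p`, with `a` occurring
exactly `k` times. -/
noncomputable def restrictedCountSeries (p : ℕ → Prop) [DecidablePred p] (a k : ℕ) : ℤ⟦X⟧ :=
  PowerSeries.mk fun n =>
    (((Nat.Partition.restricted n p).filter fun x => x.parts.count a = k).card : ℤ)

/-- The partitions with exactly `k` parts `a` arise by adding `k` parts `a` to a partition without
a part `a`. -/
theorem card_restricted_count (p : ℕ → Prop) [DecidablePred p] {a : ℕ} (ha : 0 < a) (hp : p a)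
    (n k : ℕ) (h : a * k ≤ n) :
    ((Nat.Partition.restricted n p).filter fun x => x.parts.count a = k).card =
      (Nat.Partition.restricted (n - a * k) fun i => p i ∧ i ≠ a).card := by
  classical
  refine (Finset.card_bij' (s := Nat.Partition.restricted (n - a * k) fun i => p i ∧ i ≠ a)
    (fun x _ => (⟨x.parts + Multiset.replicate k a, ?_, ?_⟩ : n.Partition))
    (fun y hy => (⟨y.parts.filter (· ≠ a), ?_, ?_⟩ : (n - a * k).Partition)) ?_ ?_ ?_ ?_).symm
  · intro i hi
    rcases Multiset.mem_add.1 hi with hi | hi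
    · exact x.parts_pos hi
    · exact (Multiset.eq_of_mem_replicate hi).symm ▸ ha
  · rw [Multiset.sum_add, x.parts_sum, Multiset.sum_replicate, smul_eq_mul, mul_comm k]
    lia
  · intro i hi
    exact y.parts_pos (Multiset.mem_of_mem_filter hi)
  · have h1 := congrArg Multiset.sum (Multiset.filter_add_not (· = a) y.parts)
    rw [Multiset.sum_add, Multiset.filter_eq', y.parts_sum, (Finset.mem_filter.1 hy).2,
      Multiset.sum_replicate, smul_eq_mul, mul_comm k] at h1
    change (y.parts.filter fun i => ¬ i = a).sum = _
    lia
  · intro x hx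
    simp only [Nat.Partition.restricted, Finset.mem_filter, Finset.mem_univ, true_and] at hx ⊢
    refine ⟨fun i hi => ?_, ?_⟩
    · rcases Multiset.mem_add.1 hi with hi | hi
      · exact (hx i hi).1
      · exact (Multiset.eq_of_mem_replicate hi).symm ▸ hp
    · rw [Multiset.count_add, Multiset.count_replicate_self, Multiset.count_eq_zero.2, zero_add]
      exact fun h => (hx a h).2 rfl
  · intro y hy
    simp only [Nat.Partition.restricted, Finset.mem_filter, Finset.mem_univ, true_and] at hy ⊢
    intro i hi
    rw [Multiset.mem_filter] at hi
    exact ⟨hy.1 i hi.1, hi.2⟩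
  · intro x hx
    simp only [Nat.Partition.restricted, Finset.mem_filter, Finset.mem_univ, true_and] at hx
    ext1
    change (x.parts + Multiset.replicate k a).filter (· ≠ a) = x.parts
    rw [Multiset.filter_add, Multiset.filter_eq_self.2 fun i hi => (hx i hi).2,
      Multiset.filter_eq_nil.2 fun i hi => by simp [Multiset.eq_of_mem_replicate hi], add_zero]
  · intro y hy
    ext1
    change y.parts.filter (· ≠ a) + Multiset.replicate k a = y.parts
    rw [← (Finset.mem_filter.1 hy).2, ← Multiset.filter_eq', add_comm]
    exact Multiset.filter_add_not (· = a) y.parts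

theorem restrictedCountSeries_eq (p : ℕ → Prop) [DecidablePred p] {a : ℕ} (ha : 0 < a) (hp : p a)
    (k : ℕ) : restrictedCountSeries p a k =
      X ^ (a * k) * restrictedSeries (fun i => p i ∧ i ≠ a) := by
  ext n
  rw [coeff_X_pow_mul', restrictedCountSeries, coeff_mk, restrictedSeries, coeff_mk]
  split_ifs with h
  · rw [card_restricted_count p ha hp n k h]
  · rw [Nat.cast_eq_zero, Finset.card_eq_zero, Finset.filter_eq_empty_iff]
    rintro x - rfl
    refine h ?_
    have h1 := congrArg Multiset.sum (Multiset.filter_add_not (· = a) x.parts)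
    rw [Multiset.sum_add, Multiset.filter_eq', x.parts_sum, Multiset.sum_replicate, smul_eq_mul,
      mul_comm] at h1
    lia

/-- Removing one part a matches the partitions of n containing a with all the admissible partitions
of n - a. -/
theorem one_sub_mul_restrictedSeries (p : ℕ → Prop) [DecidablePred p] {a : ℕ} (ha : 0 < a)
    (hp : p a) : (1 - X ^ a) * restrictedSeries p = restrictedSeries fun i => p i ∧ i ≠ a := by
  classical
  have key : restrictedSeries p = restrictedSeries (fun i => p i ∧ i ≠ a) +
      X ^ a * restrictedSeries p := by
    ext n
    rw [map_add, coeff_X_pow_mul', restrictedSeries, restrictedSeries, coeff_mk, coeff_mk,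
      coeff_mk]
    rw [← Finset.card_filter_add_card_filter_not (s := Nat.Partition.restricted n p)
      (fun x => a ∈ x.parts), add_comm, Nat.cast_add]
    congr 1
    · congr 2
      ext x
      simp only [Nat.Partition.restricted, Finset.mem_filter, Finset.mem_univ, true_and]
      constructor
      · exact fun h i hi => ⟨h.1 i hi, fun e => h.2 (e ▸ hi)⟩
      · exact fun h => ⟨fun i hi => (h i hi).1, fun hi => (h a hi).2 rfl⟩
    · split_ifs with h
      · congr 1
        refine Finset.card_bij' (fun x hx => Nat.Partition.partitionWithPartEquiv ha h
            ⟨x, (Finset.mem_filter.1 hx).2⟩)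
          (fun y _ => ((Nat.Partition.partitionWithPartEquiv ha h).symm y).1) ?_ ?_ ?_ ?_
        · intro x hx
          simp only [Nat.Partition.restricted, Finset.mem_filter, Finset.mem_univ, true_and] at hx ⊢
          intro i hi
          rw [Nat.Partition.partitionWithPartEquiv_apply_parts] at hi
          exact hx.1 i (Multiset.mem_of_mem_erase hi)
        · intro y hy
          simp only [Nat.Partition.restricted, Finset.mem_filter, Finset.mem_univ, true_and] at hy ⊢
          rw [Nat.Partition.partitionWithPartEquiv_symm_apply_parts]
          refine ⟨fun i hi => ?_, Multiset.mem_cons_self _ _⟩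
          rcases Multiset.mem_cons.1 hi with rfl | hi
          · exact hp
          · exact hy i hi
        · intro x hx
          simp
        · intro y hy
          simp
      · rw [Nat.cast_eq_zero, Finset.card_eq_zero, Finset.filter_eq_empty_iff]
        exact fun x _ hx => h (Nat.Partition.le_of_mem_parts hx)
  linear_combination key

theorem restrictedSeries_congr {p p' : ℕ → Prop} [DecidablePred p] [DecidablePred p']
    (h : ∀ i, 0 < i → (p i ↔ p' i)) : restrictedSeries p = restrictedSeries p' := by
  ext n
  simp only [restrictedSeries, coeff_mk, Nat.Partition.restricted]
  congr 2
  ext x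
  simp only [Finset.mem_filter, Finset.mem_univ, true_and]
  exact forall₂_congr fun i hi => h i (x.parts_pos hi)

theorem restrictedSeries_of_forall_not {p : ℕ → Prop} [DecidablePred p]
    (h : ∀ i, 0 < i → ¬ p i) : restrictedSeries p = 1 := by
  ext n
  simp only [restrictedSeries, coeff_mk, Nat.Partition.restricted, coeff_one]
  rcases Nat.eq_zero_or_pos n with rfl | hn
  · simp
  · rw [if_neg hn.ne', Nat.cast_eq_zero, Finset.card_eq_zero, Finset.filter_eq_empty_iff]
    intro x _ hx
    obtain ⟨i, hi⟩ := Multiset.exists_mem_of_ne_zero (s := x.parts) (by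
      rintro h0
      have := x.parts_sum
      simp [h0] at this
      lia)
    exact h i (x.parts_pos hi) (hx i hi)

theorem restrictedSeries_mul_prod (s : Finset ℕ) (hs : 0 ∉ s) :
    restrictedSeries (· ∈ s) * ∏ i ∈ s, (1 - X ^ i) = 1 := by
  classical
  induction s using Finset.induction_on with
  | empty => simpa using restrictedSeries_of_forall_not (p := (· ∈ (∅ : Finset ℕ))) (by simp)
  | insert a s ha ih =>
    rw [Finset.mem_insert, not_or] at hs
    rw [Finset.prod_insert ha, ← mul_assoc, mul_comm _ (1 - X ^ a),
      one_sub_mul_restrictedSeries _ (Nat.pos_of_ne_zero (Ne.symm hs.1))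
        (Finset.mem_insert_self a s)]
    refine Eq.trans ?_ (ih hs.2)
    congr 1
    refine restrictedSeries_congr fun i _ => ?_
    rw [Finset.mem_insert]
    constructor
    · rintro ⟨rfl | h, h'⟩
      · exact absurd rfl h'
      · exact h
    · exact fun h => ⟨Or.inr h, fun e => ha (e ▸ h)⟩

theorem coeff_restrictedSeries_congr {p p' : ℕ → Prop} [DecidablePred p] [DecidablePred p'] {n : ℕ}
    (h : ∀ i ≤ n, 0 < i → (p i ↔ p' i)) :
    coeff n (restrictedSeries p) = coeff n (restrictedSeries p') := by
  simp only [restrictedSeries, coeff_mk, Nat.Partition.restricted]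
  congr 2
  ext x
  simp only [Finset.mem_filter, Finset.mem_univ, true_and]
  exact forall₂_congr fun i hi => h i (Nat.Partition.le_of_mem_parts hi) (x.parts_pos hi)

theorem restrictedSeries_le_mul_qPoch (m : ℕ) :
    restrictedSeries (· ≤ m) * qPoch (X : ℤ⟦X⟧) m = 1 := by
  rw [← restrictedSeries_mul_prod (Finset.Icc 1 m) (by simp)]
  congr 1
  · refine restrictedSeries_congr fun i hi => ?_
    rw [Finset.mem_Icc]
    lia
  · rw [qPoch, Finset.range_eq_Ico, Finset.prod_Ico_add' (fun i => 1 - (X : ℤ⟦X⟧) ^ i)]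
    rfl

/-- The second Rogers–Ramanujan identity. -/
theorem X_pow_dvd_rogers_ramanujan (T : ℕ) :
    (X : ℤ⟦X⟧) ^ T ∣ restrictedSeries (fun a => a % 5 = 2 ∨ a % 5 = 3) -
      ∑ m ∈ Finset.range T, X ^ (m * (m + 1)) * restrictedSeries (· ≤ m) := by
  classical
  let s₂ := (Finset.range (2 * T)).image fun i => 5 * i + 2
  let s₃ := (Finset.range (2 * T)).image fun i => 5 * i + 3
  -- Modulo X^T the variable becomes nilpotent, so the identity of the previous part applies to its
  -- image.
  let φ := Ideal.Quotient.mk (Ideal.span {(X : ℤ⟦X⟧) ^ T})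
  have hT : φ X ^ T = 0 := by
    rw [← map_pow, Ideal.Quotient.eq_zero_iff_mem]
    exact Ideal.mem_span_singleton_self _
  have hq := isUnit_one_sub_pow_of_nilpotent hT
  have hs : restrictedSeries (· ∈ s₂ ∪ s₃) * ((∏ i ∈ Finset.range (2 * T), (1 - X ^ (5 * i + 2))) *
        ∏ i ∈ Finset.range (2 * T), (1 - X ^ (5 * i + 3))) = 1 := by
    have h := restrictedSeries_mul_prod (s₂ ∪ s₃) (by simp [s₂, s₃])
    rwa [Finset.prod_union, Finset.prod_image (by intro; lia),
      Finset.prod_image (by intro; lia)] at h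
    rw [Finset.disjoint_left]
    simp only [s₂, s₃, Finset.mem_image]
    rintro a ⟨i, -, rfl⟩ ⟨j, -, h⟩
    lia
  have hinv : ∀ m : ℕ, φ (restrictedSeries (· ≤ m)) = qPochInv (φ X) m := by
    intro m
    refine (isUnit_qPoch hq m).mul_left_cancel ?_
    rw [qPoch_mul_qPochInv hq, ← map_one φ, ← restrictedSeries_le_mul_qPoch m, map_mul, mul_comm]
    simp [qPoch]
  have hmain : φ (restrictedSeries (· ∈ s₂ ∪ s₃)) =
      φ (∑ m ∈ Finset.range T, X ^ (m * (m + 1)) * restrictedSeries (· ≤ m)) := by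
    have h1 := rogers_ramanujan_of_nilpotent hT
    have h2 := congrArg φ hs
    simp only [map_mul, map_prod, map_sub, map_one, map_pow, map_sum, hinv] at h2 ⊢
    generalize (∏ i ∈ Finset.range (2 * T), (1 - φ X ^ (5 * i + 2))) *
        ∏ i ∈ Finset.range (2 * T), (1 - φ X ^ (5 * i + 3)) = W at *
    generalize ∑ s ∈ Finset.range T, φ X ^ (s * (s + 1)) * qPochInv (φ X) s = S at *
    generalize φ (restrictedSeries (· ∈ s₂ ∪ s₃)) = B at *
    linear_combination (-B) * h1 + S * h2
  have hdvd : (X : ℤ⟦X⟧) ^ T ∣ restrictedSeries (· ∈ s₂ ∪ s₃) -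
      ∑ m ∈ Finset.range T, X ^ (m * (m + 1)) * restrictedSeries (· ≤ m) := by
    rw [← Ideal.mem_span_singleton]
    exact Ideal.Quotient.eq.1 hmain
  rw [X_pow_dvd_iff] at hdvd ⊢
  intro n hn
  rw [← hdvd n hn, map_sub, map_sub]
  congr 1
  -- In degree n < T only parts below T occur, and those ≡ 2, 3 mod 5 all lie in `s₂ ∪ s₃`.
  refine coeff_restrictedSeries_congr fun i hi _ => ?_
  simp only [s₂, s₃, Finset.mem_union, Finset.mem_image, Finset.mem_range]
  constructor
  · rintro (h | h)
    · exact Or.inl ⟨i / 5, by lia, by lia⟩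
    · exact Or.inr ⟨i / 5, by lia, by lia⟩
  · rintro (⟨j, -, rfl⟩ | ⟨j, -, rfl⟩) <;> lia

end Counting

/-! ### Conjugation of Ferrers diagrams. -/

section Columns

/-- In a weakly decreasing list the rows longer than j form an initial segment; this is the duality
between rows and columns. -/
theorem lt_countP_iff {l : List ℕ} (hl : l.Pairwise (· ≥ ·)) (i j : ℕ) :
    i < l.countP (fun r => j < r) ↔ j < l.getD i 0 := by
  induction l generalizing i with
  | nil => simp
  | cons a l ih =>
    rw [List.pairwise_cons] at hl
    rw [List.countP_cons]
    by_cases h : j < a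
    · rcases i with _ | i
      · simp [h]
      · simpa [h] using ih hl.2 i
    · have h0 : l.countP (fun r => j < r) = 0 := by
        rw [List.countP_eq_zero]
        intro r hr
        have := hl.1 r hr
        simp
        lia
      have h1 := ih hl.2
      rw [h0] at h1 ⊢
      rcases i with _ | i
      · simp [h]
      · have := h1 i
        simp only [h, List.getD_cons_succ, ← this]
        simp

theorem lt_foldr_max_iff (l : List ℕ) (j : ℕ) : j < l.foldr max 0 ↔ ∃ r ∈ l, j < r := by
  induction l with
  | nil => simp
  | cons a l ih => simp [ih]

theorem getD_le_foldr_max (l : List ℕ) (i : ℕ) : l.getD i 0 ≤ l.foldr max 0 := by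
  by_contra! h
  rcases lt_or_ge i l.length with hi | hi
  · rw [List.getD_eq_getElem _ _ hi] at h
    exact lt_irrefl _ ((lt_foldr_max_iff l _).2 ⟨_, List.getElem_mem hi, h⟩)
  · rw [List.getD_eq_default _ _ hi] at h
    lia

theorem countP_lt_ferrersColumns {μ : List ℕ} (hμ : μ.Pairwise (· ≥ ·)) (i : ℕ) :
    (ferrersColumns μ).countP (fun c => i < c) = μ.getD i 0 := by
  rw [ferrersColumns, Multiset.countP_map]
  simp only [lt_countP_iff hμ]
  have h := getD_le_foldr_max μ i
  change ((Finset.range _).filter fun j => j < μ.getD i 0).card = _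
  generalize μ.getD i 0 = c at *
  rw [show (Finset.range (μ.foldr max 0)).filter (fun j => j < c) =
    Finset.range c by ext; simp; lia, Finset.card_range]

theorem mem_ferrersColumns {μ : List ℕ} {c : ℕ} (hc : c ∈ ferrersColumns μ) :
    0 < c ∧ c ≤ μ.length := by
  obtain ⟨j, hj, rfl⟩ := Multiset.mem_map.1 hc
  rw [Multiset.mem_range, lt_foldr_max_iff] at hj
  refine ⟨?_, List.countP_le_length⟩
  rw [List.countP_pos_iff]
  simpa using hj

theorem count_succ_add_countP (S : Multiset ℕ) (b : ℕ) :
    S.count (b + 1) + S.countP (fun c => b + 1 < c) = S.countP (fun c => b < c) := by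
  induction S using Multiset.induction with
  | empty => simp
  | cons a S ih =>
    rw [Multiset.count_cons, Multiset.countP_cons, Multiset.countP_cons]
    split_ifs <;> lia

/-- Each positive multiplicity count is a difference of consecutive tail counts. -/
theorem multiset_eq_of_countP_lt {S T : Multiset ℕ} (hS : 0 ∉ S) (hT : 0 ∉ T)
    (h : ∀ i, S.countP (fun c => i < c) = T.countP (fun c => i < c)) : S = T := by
  ext a
  rcases a with _ | b
  · rw [Multiset.count_eq_zero.2 hS, Multiset.count_eq_zero.2 hT]
  · have h1 := count_succ_add_countP S b
    have h2 := count_succ_add_countP T b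
    rw [h, h] at h1
    lia

theorem sum_countP_lt {S : Multiset ℕ} {m : ℕ} (hS : ∀ a ∈ S, a ≤ m) :
    ∑ i ∈ Finset.range m, S.countP (fun c => i < c) = S.sum := by
  induction S using Multiset.induction with
  | empty => simp
  | cons a S ih =>
    simp only [Multiset.countP_cons, Finset.sum_add_distrib, Multiset.sum_cons]
    rw [ih fun b hb => hS b (Multiset.mem_cons_of_mem hb), Finset.sum_boole, add_comm]
    congr 1
    have := hS a (Multiset.mem_cons_self a S)
    rw [show (Finset.range m).filter (fun i => i < a) = Finset.range a by ext; simp; lia]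
    simp

theorem countP_lt_eq_zero {S : Multiset ℕ} {m i : ℕ} (hS : ∀ a ∈ S, a ≤ m) (h : m ≤ i) :
    S.countP (fun c => i < c) = 0 := by
  rw [Multiset.countP_eq_zero]
  intro a ha
  have := hS a ha
  lia

end Columns

/-! ### The correspondence between Diff₂* and column multisets. -/

section DiffTwoStar

variable {N : ℕ} {p : N.Partition}

theorem coe_partsList (p : N.Partition) : (partsList p : Multiset ℕ) = p.parts :=
  Multiset.sort_eq _ _

theorem length_partsList (p : N.Partition) : (partsList p).length = numParts p := by
  rw [numParts, ← coe_partsList, Multiset.coe_card]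

theorem mem_partsList {a : ℕ} : a ∈ partsList p ↔ a ∈ p.parts := Multiset.mem_sort _

theorem length_starRows (p : N.Partition) : (starRows p).length = numParts p := by
  rw [starRows, List.length_mapIdx, length_partsList]

theorem IsDiffTwoStar.getElem_add_le (h : IsDiffTwoStar p) {i j : ℕ} (hij : i ≤ j)
    (hj : j < (partsList p).length) :
    (partsList p)[j] + 2 * (j - i) ≤ (partsList p)[i] := by
  induction j, hij using Nat.le_induction with
  | base => simp
  | succ j hij ih =>
    have h1 := List.isChain_iff_getElem.1 h.1 j hj
    have h2 := ih (by lia)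
    lia

/-- The last part is at least 2, as 1 is excluded, and each step upwards adds at least 2. Hence the
natural subtraction in `starRows` never truncates and can be undone. -/
theorem IsDiffTwoStar.two_mul_le (h : IsDiffTwoStar p) {i : ℕ} (hi : i < (partsList p).length) :
    2 * (numParts p - i) ≤ (partsList p)[i] := by
  have h1 := h.getElem_add_le (i := i) (j := (partsList p).length - 1) (by lia) (by lia)
  have h2 : (partsList p)[(partsList p).length - 1]'(by lia) ∈ p.parts :=
    mem_partsList.1 (List.getElem_mem _)
  have h3 := p.parts_pos h2
  have h4 : (partsList p)[(partsList p).length - 1]'(by lia) ≠ 1 := fun e => h.2 (e ▸ h2)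
  rw [← length_partsList]
  lia

theorem getElem_starRows {i : ℕ} (hi : i < (partsList p).length) :
    (starRows p)[i]'(by rwa [length_starRows, ← length_partsList]) =
      (partsList p)[i] - 2 * (numParts p - i) := by
  simp [starRows]

theorem IsDiffTwoStar.pairwise_starRows (h : IsDiffTwoStar p) :
    (starRows p).Pairwise (· ≥ ·) := by
  rw [List.pairwise_iff_getElem]
  intro i j hi hj hij
  rw [length_starRows, ← length_partsList] at hi hj
  rw [getElem_starRows hi, getElem_starRows hj]
  have h1 := h.getElem_add_le hij.le hj
  rw [← length_partsList]
  lia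

theorem IsDiffTwoStar.getElem_partsList (h : IsDiffTwoStar p) {i : ℕ}
    (hi : i < (partsList p).length) :
    (partsList p)[i] = (colStar p).countP (fun c => i < c) + 2 * (numParts p - i) := by
  rw [colStar, countP_lt_ferrersColumns h.pairwise_starRows,
    List.getD_eq_getElem _ _ (by rwa [length_starRows, ← length_partsList]), getElem_starRows hi]
  have := h.two_mul_le hi
  lia

theorem mem_colStar {c : ℕ} (hc : c ∈ colStar p) : 0 < c ∧ c ≤ numParts p := by
  rw [← length_starRows]
  exact mem_ferrersColumns hc

theorem IsDiffTwoStar.partsList_eq (h : IsDiffTwoStar p) :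
    partsList p = (List.range (numParts p)).map
      fun i => (colStar p).countP (fun c => i < c) + 2 * (numParts p - i) := by
  refine List.ext_getElem (by simp [length_partsList]) fun i hi _ => ?_
  rw [h.getElem_partsList hi]
  simp

theorem sum_two_mul_sub (m : ℕ) : ∑ i ∈ Finset.range m, 2 * (m - i) = m * (m + 1) := by
  induction m with
  | zero => rfl
  | succ m ih =>
    rw [Finset.sum_range_succ', Finset.sum_congr rfl fun i _ => by rw [Nat.add_sub_add_right], ih]
    simp
    ring

theorem sum_rows_add {S : Multiset ℕ} {m : ℕ} (hS : ∀ a ∈ S, a ≤ m) :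
    ((List.range m).map fun i => S.countP (fun c => i < c) + 2 * (m - i)).sum =
      S.sum + m * (m + 1) := by
  rw [← sum_countP_lt hS, ← sum_two_mul_sub, ← Finset.sum_add_distrib]
  rfl

theorem IsDiffTwoStar.sum_colStar (h : IsDiffTwoStar p) :
    (colStar p).sum + numParts p * (numParts p + 1) = N := by
  rw [← sum_rows_add fun a ha => (mem_colStar ha).2, ← h.partsList_eq, ← Multiset.sum_coe,
    coe_partsList, p.parts_sum]

/-- The partition in `Diff₂*` with `m` parts whose associated column lengths form `S`. -/
def ofColumns (S : Multiset ℕ) (m N : ℕ) (hS : ∀ a ∈ S, a ≤ m) (hN : S.sum + m * (m + 1) = N) :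
    N.Partition where
  parts := ((List.range m).map fun i => S.countP (fun c => i < c) + 2 * (m - i) : List ℕ)
  parts_pos := by
    intro a ha
    simp only [Multiset.mem_coe, List.mem_map, List.mem_range] at ha
    obtain ⟨i, hi, rfl⟩ := ha
    lia
  parts_sum := by rw [Multiset.sum_coe, sum_rows_add hS, hN]

variable {S : Multiset ℕ} {m : ℕ} (hS : ∀ a ∈ S, a ≤ m) (hN : S.sum + m * (m + 1) = N)

theorem numParts_ofColumns : numParts (ofColumns S m N hS hN) = m := by
  simp [numParts, ofColumns]

theorem pairwise_rows (S : Multiset ℕ) (m : ℕ) :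
    ((List.range m).map fun i => S.countP (fun c => i < c) + 2 * (m - i)).Pairwise
      fun a b => b + 2 ≤ a := by
  rw [List.pairwise_map]
  refine List.Pairwise.imp_of_mem ?_ (List.pairwise_lt_range (n := m))
  intro i j hi hj hij
  rw [List.mem_range] at hi hj
  have : S.countP (fun c => j < c) ≤ S.countP (fun c => i < c) := by
    rw [Multiset.countP_eq_card_filter, Multiset.countP_eq_card_filter]
    exact Multiset.card_le_card (Multiset.monotone_filter_right S fun a h => hij.trans h)
  lia

theorem partsList_ofColumns : partsList (ofColumns S m N hS hN) =
    (List.range m).map fun i => S.countP (fun c => i < c) + 2 * (m - i) := by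
  refine List.Perm.eq_of_pairwise' (r := (· ≥ ·)) (Multiset.pairwise_sort _ _)
    ((pairwise_rows S m).imp fun h => by lia) ?_
  rw [← Multiset.coe_eq_coe, coe_partsList]
  rfl

theorem isDiffTwoStar_ofColumns : IsDiffTwoStar (ofColumns S m N hS hN) := by
  refine ⟨?_, ?_⟩
  · rw [IsDiffTwo, partsList_ofColumns]
    exact (pairwise_rows S m).isChain
  · rw [← mem_partsList, partsList_ofColumns]
    simp only [List.mem_map, List.mem_range]
    rintro ⟨i, hi, h⟩
    lia

theorem colStar_ofColumns (hS0 : 0 ∉ S) : colStar (ofColumns S m N hS hN) = S := by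
  refine multiset_eq_of_countP_lt (fun h => (mem_colStar h).1.ne rfl) hS0 fun i => ?_
  rcases lt_or_ge i m with hi | hi
  · have h := (isDiffTwoStar_ofColumns hS hN).getElem_partsList (i := i)
      (by rwa [length_partsList, numParts_ofColumns])
    simp only [partsList_ofColumns, numParts_ofColumns, List.getElem_map,
      List.getElem_range] at h
    lia
  · rw [countP_lt_eq_zero hS hi, countP_lt_eq_zero (m := m) (fun a ha => ?_) hi]
    have := (mem_colStar ha).2
    rwa [numParts_ofColumns] at this

/-- Partitions in `Diff₂*` with `m` parts correspond to partitions with parts at most `m`. -/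
theorem card_diffTwoStar (N m : ℕ) (φ : Multiset ℕ → Prop) [DecidablePred φ]
    [DecidablePred fun p : N.Partition => IsDiffTwoStar p ∧ numParts p = m ∧ φ (colStar p)] :
    (Finset.univ.filter fun p : N.Partition =>
        IsDiffTwoStar p ∧ numParts p = m ∧ φ (colStar p)).card =
      if m * (m + 1) ≤ N then
        ((Nat.Partition.restricted (N - m * (m + 1)) (· ≤ m)).filter fun x => φ x.parts).card
      else 0 := by
  split_ifs with h
  · refine Finset.card_bij'
      (fun p hp => (⟨colStar p, fun hi => (mem_colStar hi).1, ?_⟩ :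
        (N - m * (m + 1)).Partition))
      (fun x hx => ofColumns x.parts m N ?_ ?_) ?_ ?_ ?_ ?_
    · obtain ⟨-, hstar, rfl, -⟩ := Finset.mem_filter.1 hp
      have := hstar.sum_colStar
      lia
    · exact (Finset.mem_filter.1 (Finset.mem_filter.1 hx).1).2
    · rw [x.parts_sum]
      lia
    · intro p hp
      obtain ⟨-, -, rfl, hφ⟩ := Finset.mem_filter.1 hp
      simp only [Nat.Partition.restricted, Finset.mem_filter, Finset.mem_univ, true_and]
      exact ⟨fun a ha => (mem_colStar ha).2, hφ⟩
    · intro x hx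
      refine Finset.mem_filter.2 ⟨Finset.mem_univ _, isDiffTwoStar_ofColumns _ _,
        numParts_ofColumns _ _, ?_⟩
      rw [colStar_ofColumns _ _ fun h => (x.parts_pos h).ne rfl]
      exact (Finset.mem_filter.1 hx).2
    · intro p hp
      obtain ⟨-, hstar, rfl, -⟩ := Finset.mem_filter.1 hp
      ext1
      rw [← coe_partsList p, hstar.partsList_eq]
      rfl
    · intro x hx
      ext1
      exact colStar_ofColumns _ _ fun h => (x.parts_pos h).ne rfl
  · rw [Finset.card_eq_zero, Finset.filter_eq_empty_iff]
    rintro p - ⟨hp, rfl, -⟩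
    have := hp.sum_colStar
    lia

end DiffTwoStar

/-! ### Reading the factor F combinatorially, by number of parts. -/

section Refinement

open PowerSeries

theorem ncard_setOf_eq_card_filter {α : Type*} [Fintype α] (P : α → Prop) [DecidablePred P] :
    Set.ncard {x | P x} = (Finset.univ.filter P).card := by
  rw [← Set.ncard_coe_finset]
  simp

theorem numParts_le {N : ℕ} (p : N.Partition) : numParts p ≤ N := by
  have h := Multiset.card_nsmul_le_sum (s := p.parts) (a := 1) fun i hi => p.parts_pos hi
  rw [p.parts_sum] at h
  simpa [numParts] using h

theorem card_diffTwoStar_eq_coeff (N m : ℕ) (φ : Multiset ℕ → Prop) [DecidablePred φ]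
    [DecidablePred fun p : N.Partition => IsDiffTwoStar p ∧ numParts p = m ∧ φ (colStar p)] :
    ((Finset.univ.filter fun p : N.Partition =>
        IsDiffTwoStar p ∧ numParts p = m ∧ φ (colStar p)).card : ℤ) =
      coeff N (X ^ (m * (m + 1)) * (PowerSeries.mk fun n =>
        (((Nat.Partition.restricted n (· ≤ m)).filter fun x => φ x.parts).card : ℤ))) := by
  rw [card_diffTwoStar, coeff_X_pow_mul', coeff_mk]
  split_ifs <;> simp

/-- Since a ≤ m, the size a is an admissible column length: 1 - X^a forbids it and X^(ak) restores k
copies. -/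
theorem card_diffTwoStar_count (N m a k : ℕ) (ha : 0 < a) (ham : a ≤ m)
    [DecidablePred fun p : N.Partition =>
      IsDiffTwoStar p ∧ numParts p = m ∧ (colStar p).count a = k] :
    ((Finset.univ.filter fun p : N.Partition =>
        IsDiffTwoStar p ∧ numParts p = m ∧ (colStar p).count a = k).card : ℤ) =
      coeff N (X ^ (a * k) * (1 - X ^ a) * (X ^ (m * (m + 1)) * restrictedSeries (· ≤ m))) := by
  rw [card_diffTwoStar_eq_coeff N m fun S => S.count a = k]
  change coeff N (_ * restrictedCountSeries (· ≤ m) a k) = _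
  rw [restrictedCountSeries_eq _ ha ham, ← one_sub_mul_restrictedSeries (· ≤ m) ha ham]
  congr 1
  ring

/-- When M + 1 > m is not a possible column length, 1 - X^(M+1) is factored as (1 - X)(1 + ⋯ + X^M):
ones are forbidden, then A + c of them are restored, 0 ≤ c ≤ M. -/
theorem card_diffTwoStar_count_one_mem_Icc (N m A M : ℕ) (hm : 1 ≤ m)
    [DecidablePred fun p : N.Partition => IsDiffTwoStar p ∧ numParts p = m ∧
      (A ≤ (colStar p).count 1 ∧ (colStar p).count 1 ≤ A + M)] :
    ((Finset.univ.filter fun p : N.Partition => IsDiffTwoStar p ∧ numParts p = m ∧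
        (A ≤ (colStar p).count 1 ∧ (colStar p).count 1 ≤ A + M)).card : ℤ) =
      coeff N (X ^ A * (1 - X ^ (M + 1)) * (X ^ (m * (m + 1)) * restrictedSeries (· ≤ m))) := by
  rw [card_diffTwoStar_eq_coeff N m fun S => A ≤ S.count 1 ∧ S.count 1 ≤ A + M]
  have hsum : (PowerSeries.mk fun n => (((Nat.Partition.restricted n (· ≤ m)).filter
      fun x => A ≤ x.parts.count 1 ∧ x.parts.count 1 ≤ A + M).card : ℤ)) =
      ∑ c ∈ Finset.range (M + 1), restrictedCountSeries (· ≤ m) 1 (A + c) := by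
    ext n
    rw [coeff_mk, map_sum]
    simp only [restrictedCountSeries, coeff_mk]
    rw [Finset.card_eq_sum_card_fiberwise (f := fun x => x.parts.count 1 - A)
      (t := Finset.range (M + 1)), Nat.cast_sum]
    · refine Finset.sum_congr rfl fun c hc => ?_
      rw [Finset.mem_range] at hc
      congr 2
      rw [Finset.filter_filter]
      refine Finset.filter_congr fun x _ => ?_
      lia
    · intro x hx
      have := (Finset.mem_filter.1 hx).2
      simp only [Finset.coe_range, Set.mem_Iio]
      lia
  have hterm : ∀ c ∈ Finset.range (M + 1), restrictedCountSeries (· ≤ m) 1 (A + c) =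
      X ^ A * ((1 - X) * restrictedSeries (· ≤ m)) * X ^ c := by
    intro c _
    have h := one_sub_mul_restrictedSeries (· ≤ m) one_pos hm
    rw [pow_one] at h
    rw [restrictedCountSeries_eq _ one_pos hm, ← h, one_mul, pow_add]
    ring
  rw [hsum, Finset.sum_congr rfl hterm, ← Finset.mul_sum, ← mul_neg_geom_sum]
  congr 1
  ring

theorem restrictedSeries_le_one : restrictedSeries (· ≤ 1) = PowerSeries.mk 1 := by
  have h := restrictedSeries_le_mul_qPoch 1
  have h' : qPoch (X : ℤ⟦X⟧) 1 = 1 - X := by simp [qPoch]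
  rw [h'] at h
  calc restrictedSeries (· ≤ 1) = restrictedSeries (· ≤ 1) * ((PowerSeries.mk 1) * (1 - X)) := by
        rw [mk_one_mul_one_sub_eq_one, mul_one]
    _ = restrictedSeries (· ≤ 1) * (1 - X) * PowerSeries.mk 1 := by ring
    _ = PowerSeries.mk 1 := by rw [h, one_mul]

theorem card_diffTwoStar_one_part {N : ℕ} (hN : 2 ≤ N)
    [DecidablePred fun p : N.Partition => IsDiffTwoStar p ∧ numParts p = 1] :
    (Finset.univ.filter fun p : N.Partition => IsDiffTwoStar p ∧ numParts p = 1).card = 1 := by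
  classical
  have h := card_diffTwoStar_eq_coeff N 1 fun _ => True
  have h1 := restrictedSeries_le_one
  rw [restrictedSeries] at h1
  simp only [and_true, Finset.filter_true] at h
  rw [h1, coeff_X_pow_mul', if_pos (by lia), coeff_mk] at h
  rw [← Nat.cast_inj (R := ℤ), Nat.cast_one, ← Pi.one_apply (M := fun _ => ℤ) (N - 1 * (1 + 1)), ← h]

/-- The product is X^A (1 - X^(M+1) + X^2 + ⋯ + X^(M+2)). As M ≥ 1, the negative term cancels
X^(M+1), which explains the gap at i = M + 1. -/
theorem coeff_one_part {M : ℕ} (hM : 1 ≤ M) (A N : ℕ)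
    [Decidable (N = A ∨ ∃ i : ℕ, ((2 ≤ i ∧ i ≤ M) ∨ i = M + 2) ∧ N = A + i)] :
    coeff N (X ^ A * (1 - X ^ (M + 1)) * (1 + X ^ 2 * restrictedSeries (· ≤ 1))) =
      if N = A ∨ ∃ i : ℕ, ((2 ≤ i ∧ i ≤ M) ∨ i = M + 2) ∧ N = A + i then 1 else 0 := by
  have hgeom : (1 - X ^ (M + 1)) * restrictedSeries (· ≤ 1) =
      ∑ i ∈ Finset.range (M + 1), (X : ℤ⟦X⟧) ^ i := by
    rw [restrictedSeries_le_one, ← mul_neg_geom_sum, mul_right_comm, mul_comm (1 - X),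
      mk_one_mul_one_sub_eq_one, one_mul]
  have hexp : X ^ A * (1 - X ^ (M + 1)) * (1 + X ^ 2 * restrictedSeries (· ≤ 1)) =
      X ^ A * (1 - X ^ (M + 1) + X ^ 2 * ∑ i ∈ Finset.range (M + 1), (X : ℤ⟦X⟧) ^ i) := by
    rw [← hgeom]
    ring
  rw [hexp, coeff_X_pow_mul']
  by_cases hA : A ≤ N
  · obtain ⟨n, rfl⟩ := Nat.exists_eq_add_of_le hA
    have hP : (A + n = A ∨ ∃ i : ℕ, ((2 ≤ i ∧ i ≤ M) ∨ i = M + 2) ∧ A + n = A + i) ↔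
        n = 0 ∨ (2 ≤ n ∧ n ≤ M) ∨ n = M + 2 := by
      constructor
      · rintro (h | ⟨i, hi, h⟩) <;> lia
      · rintro (h | h)
        · exact Or.inl (by lia)
        · exact Or.inr ⟨n, h, rfl⟩
    rw [if_congr hP rfl rfl, if_pos hA, Nat.add_sub_cancel_left, map_add, map_sub, coeff_one, coeff_X_pow,
      coeff_X_pow_mul', map_sum]
    simp only [coeff_X_pow, Finset.sum_ite_eq, Finset.mem_range]
    split_ifs <;> lia
  · rw [if_neg hA, if_neg]
    rintro (h | ⟨i, hi, h⟩) <;> lia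

theorem sum_range_add_two {A : Type*} [AddCommMonoid A] (f : ℕ → A) (n : ℕ) :
    ∑ m ∈ Finset.range (n + 1 + 1), f m = ∑ m ∈ Finset.range n, f (m + 2) + (f 1 + f 0) := by
  rw [Finset.sum_range_succ', Finset.sum_range_succ', add_assoc]

end Refinement

/-! ### Comparison of coefficients. -/

theorem mainTheorem5 (M : ℕ) (hM : (M + 1) % 5 = 2 ∨ (M + 1) % 5 = 3)
    (N : ℕ) (hN : 1 ≤ N) (k : ℕ) :
    Set.ncard {p : N.Partition |
        (∀ a ∈ p.parts, a % 5 = 2 ∨ a % 5 = 3) ∧ p.parts.count (M + 1) = k} =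
      Set.ncard {p : N.Partition |
        IsDiffTwoStar p ∧
          ((numParts p = 1 ∧
              (N = (M + 1) * k ∨
                ∃ i : ℕ, ((2 ≤ i ∧ i ≤ M) ∨ i = M + 2) ∧ N = (M + 1) * k + i)) ∨
            (2 ≤ numParts p ∧ numParts p ≤ M ∧
              (M + 1) * k ≤ (colStar p).count 1 ∧
              (colStar p).count 1 ≤ (M + 1) * k + M) ∨
            (M + 1 ≤ numParts p ∧ (colStar p).count (M + 1) = k))} := by
  classical
  have hM1 : 1 ≤ M := by lia
  rw [ncard_setOf_eq_card_filter, ncard_setOf_eq_card_filter, ← Nat.cast_inj (R := ℤ)]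
  set F : PowerSeries ℤ := PowerSeries.X ^ ((M + 1) * k) * (1 - PowerSeries.X ^ (M + 1)) with hF
  have hleft : ((Finset.univ.filter fun p : N.Partition =>
      (∀ a ∈ p.parts, a % 5 = 2 ∨ a % 5 = 3) ∧ p.parts.count (M + 1) = k).card : ℤ) =
      PowerSeries.coeff N (F * restrictedSeries fun a => a % 5 = 2 ∨ a % 5 = 3) := by
    rw [hF, mul_assoc, one_sub_mul_restrictedSeries _ M.succ_pos hM,
      ← restrictedCountSeries_eq _ M.succ_pos hM, restrictedCountSeries, PowerSeries.coeff_mk,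
      Nat.Partition.restricted, Finset.filter_filter]
  have hrr : PowerSeries.coeff N (F * restrictedSeries fun a => a % 5 = 2 ∨ a % 5 = 3) =
      PowerSeries.coeff N (F * ∑ m ∈ Finset.range (N + 1),
        PowerSeries.X ^ (m * (m + 1)) * restrictedSeries (· ≤ m)) := by
    rw [← sub_eq_zero, ← map_sub, ← mul_sub]
    exact PowerSeries.X_pow_dvd_iff.1
      (dvd_mul_of_dvd_right (X_pow_dvd_rogers_ramanujan (N + 1)) F) N N.lt_succ_self
  rw [hleft, hrr]
  rw [Finset.card_eq_sum_card_fiberwise (f := fun p => numParts p) (t := Finset.range (N + 1))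
    (fun p _ => by simpa [Nat.lt_succ_iff] using numParts_le p), Nat.cast_sum]
  -- N ≥ 1 makes the terms m = 0 and m = 1 both present, so they can be split off and treated
  -- jointly.
  obtain ⟨n, rfl⟩ := Nat.exists_eq_add_of_le' hN
  rw [sum_range_add_two, sum_range_add_two, mul_add, map_add, Finset.mul_sum, map_sum]
  congr 1
  · refine Finset.sum_congr rfl fun m _ => ?_
    rcases le_or_gt (m + 2) M with h | h
    · rw [hF, ← card_diffTwoStar_count_one_mem_Icc _ _ _ _ (by lia), Finset.filter_filter]
      congr 2
      refine Finset.filter_congr fun p _ => ?_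
      constructor
      · rintro ⟨h1, h2, h3⟩
        exact ⟨⟨h1, Or.inr (Or.inl ⟨by lia, by lia, h3⟩)⟩, h2⟩
      · rintro ⟨⟨h1, h3 | ⟨-, -, h3⟩ | h3⟩, h2⟩
        · lia
        · exact ⟨h1, h2, h3⟩
        · lia
    · rw [hF, ← card_diffTwoStar_count _ _ _ _ M.succ_pos (by lia), Finset.filter_filter]
      congr 2
      refine Finset.filter_congr fun p _ => ?_
      constructor
      · rintro ⟨h1, h2, h3⟩
        exact ⟨⟨h1, Or.inr (Or.inr ⟨by lia, h3⟩)⟩, h2⟩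
      · rintro ⟨⟨h1, h3 | h3 | ⟨-, h3⟩⟩, h2⟩
        · lia
        · lia
        · exact ⟨h1, h2, h3⟩
  · have hle0 : restrictedSeries (· ≤ 0) = 1 :=
      restrictedSeries_of_forall_not fun i hi => by lia
    have hzero : (Finset.univ.filter fun p : (n + 1).Partition => (IsDiffTwoStar p ∧
        ((numParts p = 1 ∧ (n + 1 = (M + 1) * k ∨
            ∃ i : ℕ, ((2 ≤ i ∧ i ≤ M) ∨ i = M + 2) ∧ n + 1 = (M + 1) * k + i)) ∨
          (2 ≤ numParts p ∧ numParts p ≤ M ∧ (M + 1) * k ≤ (colStar p).count 1 ∧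
            (colStar p).count 1 ≤ (M + 1) * k + M) ∨
          (M + 1 ≤ numParts p ∧ (colStar p).count (M + 1) = k))) ∧ numParts p = 0) = ∅ := by
      rw [Finset.filter_eq_empty_iff]
      rintro p - ⟨⟨-, h⟩, h0⟩
      lia
    have hone := coeff_one_part hM1 ((M + 1) * k) (n + 1)
    rw [Finset.filter_filter, Finset.filter_filter, hzero, Finset.card_empty, Nat.cast_zero,
      add_zero, hle0]
    simp only [zero_mul, pow_zero, one_mul, one_add_one_eq_two]
    rw [add_comm _ (1 : PowerSeries ℤ), hF, hone]
    split_ifs with h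
    -- A one-part member of Diff₂* exists only for N ≥ 2. The case N = (M+1)k with k = 0 is excluded
    -- by N ≥ 1, and otherwise (M+1)k ≥ 2.
    · have h2 : 2 ≤ n + 1 := by
        rcases h with h | ⟨i, hi, h⟩
        · rcases k with _ | k
          · lia
          · nlinarith
        · lia
      have hcard := card_diffTwoStar_one_part h2
      refine (Nat.cast_eq_one.2 (Eq.trans ?_ hcard)).symm
      refine congrArg Finset.card (Finset.filter_congr fun p _ => ?_)
      symm
      constructor
      · exact fun hp => ⟨⟨hp.1, Or.inl ⟨hp.2, h⟩⟩, hp.2⟩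
      · exact fun hp => ⟨hp.1.1, hp.2⟩
    · symm
      rw [Nat.cast_eq_zero, Finset.card_eq_zero, Finset.filter_eq_empty_iff]
      rintro p - ⟨⟨-, h1 | h1 | h1⟩, h2⟩
      · exact h h1.2
      · lia
      · lia
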